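/- Let $k\ge 0$ and fix $2k$ points on the boundary circle of a disk, labelled $1,\dots,2k$ in order along the circle. An \emph{OG tree} is a plane tree $T$ drawn in the disk without crossings, whose leaves (its external vertices $\mathcal V_{\rm ext}(T)$, at least two) are boundary points and whose remaining (internal) vertices $\mathcal V_{\rm int}(T)$ lie inside the disk and all have even degree at least $4$; a single edge joining two boundary points is allowed. An \emph{OG forest of type $k$} is a set $F$ of pairwise non-crossing OG trees such that each of the $2k$ boundary points is an external vertex of exactly one tree of $F$; forests are considered up to isotopy of the disk fixing the boundary. Put $$\dim_{\mathcal O}T=\begin{cases}0,&|\mathcal V_{\rm ext}(T)|=2,\\ \sum_{v\in\mathcal V_{\rm int}(T)}(\deg(v)-3),&|\mathcal V_{\rm ext}(T)|>2,\end{cases}\qquad \dim_{\mathcal O}F=\sum_{T\in F}\dim_{\mathcal O}T .$$ Let $f_d$ be the number of OG forests of type $k$ with $\dim_{\mathcal O}F=d$ and $\chi_k=f_0-f_1+f_2-\cdots$. In $\mathbb Z[q][[x]]$ let $F(x,q)=\sum_{d=4,6,8,\dots}q^{d-3}x^d$ and $$\mathcal G_{\rm tree}^{\mathcal O}(x,q)=x\Bigl(x-\tfrac1xF(x,q)\Bigr)^{\langle-1\rangle}_x,\qquad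 \mathcal G_{\rm forest}^{\mathcal O}(x,q)=\frac1x\Bigl(\frac{x}{1+\mathcal G_{\rm tree}^{\mathcal O}(x,q)}\Bigr)^{\langle-1\rangle}_x,$$ where $(\cdot)^{\langle-1\rangle}_x$ denotes the compositional inverse with respect to $x$. Then both compositional inverses exist, $\mathcal G_{\rm forest}^{\mathcal O}(x,-1)=\frac1{1-x^2}$, and for every $k\ge 0$ there are only finitely many OG forests of type $k$, $$[x^{2k}]\,\mathcal G_{\rm forest}^{\mathcal O}(x,q)=\sum_{F}q^{\dim_{\mathcal O}F},$$ where the sum is over all OG forests $F$ of type $k$, and $$\chi_k=\sum_{F}(-1)^{\dim_{\mathcal O}F}=[x^{2k}]\,\mathcal G_{\rm forest}^{\mathcal O}(x,-1)=1 .$$ -/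

import Mathlib

/-- A rooted plane tree whose leaves carry labels in `α`: a vertex `node m c` has the `m` linearly
ordered children `c 0, …, c (m - 1)`.  The edge towards the root is not one of the children. -/
inductive PlaneTree (α : Type) : Type
  | leaf (a : α) : PlaneTree α
  | node (m : ℕ) (c : Fin m → PlaneTree α) : PlaneTree α

namespace PlaneTree

/-- The leaf labels, in the order in which the contour walk around the tree meets them. -/
def leaves {α : Type} : PlaneTree α → List α
  | leaf a => [a]
  | node _ c => (List.ofFn fun i => leaves (c i)).flatten

/-- The list of the degrees of the internal vertices (one entry for each internal vertex).
A vertex with `m` children has degree `m + 1`: the extra edge leads towards the root. -/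
def degrees {α : Type} : PlaneTree α → List ℕ
  | leaf _ => []
  | node m c => (m + 1) :: (List.ofFn fun i => degrees (c i)).flatten

end PlaneTree

/-- An OG tree drawn in the disk, with its external vertices among `n` boundary points that are
numbered in order along the boundary circle.  The tree is planted at its external vertex of least
label, `root`, which is joined by an edge to the top of `body`; reading the rest of the tree in
contour order makes the cyclic order of the edges around every vertex a linear order.  The drawing
lies in the disk without crossings exactly when the contour walk meets the remaining external
vertices in the order of their labels.  Internal vertices have even degree at least `4`
(a vertex of degree `2` is a point of an edge). -/
structure OGTree (n : ℕ) : Type where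
  root : Fin n
  body : PlaneTree (Fin n)
  planar : (root :: body.leaves).Pairwise (· < ·)
  even_degrees : ∀ d ∈ body.degrees, Even d ∧ 4 ≤ d

namespace OGTree

/-- The external vertices of the tree, in the order of their labels. -/
def ext {n : ℕ} (T : OGTree n) : List (Fin n) := T.root :: T.body.leaves

/-- The dimension of an OG tree: `0` if it has two external vertices, and otherwise the sum of
`deg v - 3` over its internal vertices `v` (all these degrees are at least `4`). -/
def dim {n : ℕ} (T : OGTree n) : ℕ :=
  if T.ext.length = 2 then 0 else (T.body.degrees.map fun d => d - 3).sum

/-- Two trees in the disk cross: going along the circle one meets, alternately, external vertices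
of the one and of the other. -/
def Crosses {n : ℕ} (T T' : OGTree n) : Prop :=
  ∃ a b c d : Fin n, a < b ∧ b < c ∧ c < d ∧ a ∈ T.ext ∧ b ∈ T'.ext ∧ c ∈ T.ext ∧ d ∈ T'.ext

end OGTree

/-- An OG forest of type `k`: finitely many pairwise non-crossing OG trees in the disk such that
each of the `2k` boundary points is an external vertex of exactly one of them. -/
structure OGForest (k : ℕ) : Type where
  trees : Finset (OGTree (2 * k))
  cover : ∀ i : Fin (2 * k), ∃! T, T ∈ trees ∧ i ∈ T.ext
  noncrossing : ∀ T ∈ trees, ∀ T' ∈ trees, T ≠ T' → ¬ T.Crosses T'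

namespace OGForest

/-- The dimension of an OG forest is the sum of the dimensions of its trees. -/
def dim {k : ℕ} (F : OGForest k) : ℕ := ∑ T ∈ F.trees, T.dim

/-- The number `f_d` of OG forests of type `k` and dimension `d`. -/
noncomputable def fVector (k d : ℕ) : ℕ := Nat.card {F : OGForest k // F.dim = d}

/-- The Euler characteristic `f_0 - f_1 + f_2 - ⋯`. -/
noncomputable def eulerChar (k : ℕ) : ℤ := ∑ᶠ d : ℕ, (-1) ^ d * (fVector k d : ℤ)

end OGForest

/-! Generating functions: power series in `x` with coefficients in `ℤ[q]`. -/

namespace OGForest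

/-- The power series `(f - f(0)) / x`. -/
noncomputable def divX (f : PowerSeries (Polynomial ℤ)) : PowerSeries (Polynomial ℤ) :=
  PowerSeries.mk fun n => PowerSeries.coeff (n + 1) f

/-- `g` is the compositional inverse of `f` with respect to `x`, both without constant term. -/
def IsCompInverse (f g : PowerSeries (Polynomial ℤ)) : Prop :=
  PowerSeries.constantCoeff f = 0 ∧ PowerSeries.constantCoeff g = 0 ∧
    (PowerSeries.subst g f : PowerSeries (Polynomial ℤ)) = PowerSeries.X ∧
    (PowerSeries.subst f g : PowerSeries (Polynomial ℤ)) = PowerSeries.X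

open Classical in
/-- The compositional inverse with respect to `x`; it is unique if it exists, and `0` otherwise. -/
noncomputable def compInverse (f : PowerSeries (Polynomial ℤ)) : PowerSeries (Polynomial ℤ) :=
  if h : ∃ g, IsCompInverse f g then h.choose else 0

/-- `F(x, q) = ∑ q ^ (d - 3) x ^ d` over `d = 4, 6, 8, …`. -/
noncomputable def vertexGF : PowerSeries (Polynomial ℤ) :=
  PowerSeries.mk fun d => if Even d ∧ 4 ≤ d then Polynomial.X ^ (d - 3) else 0

/-- The series `x - F(x, q) / x`. -/
noncomputable def treeKernel : PowerSeries (Polynomial ℤ) := PowerSeries.X - divX vertexGF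

/-- The generating function of OG trees, `x (x - F(x, q) / x)^{⟨-1⟩}`. -/
noncomputable def treeGF : PowerSeries (Polynomial ℤ) := PowerSeries.X * compInverse treeKernel

/-- The series `x / (1 + G_tree(x, q))`; the denominator has constant term `1`. -/
noncomputable def forestKernel : PowerSeries (Polynomial ℤ) :=
  PowerSeries.X * PowerSeries.invOfUnit (1 + treeGF) 1

/-- The generating function of OG forests, `(1 / x) (x / (1 + G_tree(x, q)))^{⟨-1⟩}`. -/
noncomputable def forestGF : PowerSeries (Polynomial ℤ) := divX (compInverse forestKernel)

end OGForest

/-! Plant a tree at its least label. What hangs there is a single leaf, or a vertex of degree d that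
contributes q ^ (d - 3) and carries d - 1 further planted trees. So planted trees are counted by the
g with g = x + F(g) / g, the inverse of the tree kernel (`PlaneTree.exists_trees_eq_coeff`). The
root contributes one more x. As contour order is label order, the weighted number of trees on a
nonempty set of labels depends only on its size and is a coefficient of x g
(`OGTree.sum_extSet_eq`).

A nonempty forest amounts to the tree through its least point and a forest in the gap after each
external vertex of that tree, whence Φ = 1 + G_tree(x Φ). The series `forestGF` satisfies this
equation (`forestGF_eq`), and any solution counts forests (`tilingSum_Ico`).

At q = -1 the tree kernel is x / (1 - x ^ 2). With u = g(x Φ) the relations Φ = 1 + x Φ u and x Φ (1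
- u ^ 2) = u force u = x, hence Φ = 1 / (1 - x ^ 2) (`one_sub_X_sq_mul_map_forestGF`). -/

namespace OGForest

/-! ### Functional equations of the generating functions, and q = -1 -/

open PowerSeries

theorem exists_isCompInverse {f : PowerSeries (Polynomial ℤ)} (h0 : constantCoeff f = 0)
    (h1 : coeff 1 f = 1) : ∃ g, IsCompInverse f g :=
  have hu : IsUnit (coeff 1 f) := by simp [h1]
  ⟨f.substInvOfIsUnit hu, h0, constantCoeff_substInvOfIsUnit ..,
    subst_substInvOfIsUnit_right _ h0 _, subst_substInvOfIsUnit_left _ h0 _⟩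

theorem isCompInverse_compInverse {f : PowerSeries (Polynomial ℤ)} (h0 : constantCoeff f = 0)
    (h1 : coeff 1 f = 1) : IsCompInverse f (compInverse f) := by
  have h := exists_isCompInverse h0 h1
  rw [compInverse, dif_pos h]
  exact h.choose_spec

theorem coeff_divX (f : PowerSeries (Polynomial ℤ)) (n : ℕ) :
    coeff n (divX f) = coeff (n + 1) f := by
  simp [divX]

theorem X_mul_divX {f : PowerSeries (Polynomial ℤ)} (h : constantCoeff f = 0) :
    X * divX f = f := by
  ext1 n
  cases n with
  | zero => simp [h]
  | succ n => rw [coeff_succ_X_mul, coeff_divX]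

theorem coeff_divX_vertexGF (m : ℕ) :
    coeff m (divX vertexGF) = if Odd m ∧ 3 ≤ m then Polynomial.X ^ (m - 2) else 0 := by
  rw [coeff_divX, vertexGF, coeff_mk]
  have : (Even (m + 1) ∧ 4 ≤ m + 1) ↔ (Odd m ∧ 3 ≤ m) := by
    rw [Nat.even_add_one, Nat.not_even_iff_odd]
    exact and_congr_right fun _ => by omega
  simp only [this]
  rfl

theorem isCompInverse_treeKernel : IsCompInverse treeKernel (compInverse treeKernel) := by
  apply isCompInverse_compInverse
  · rw [← coeff_zero_eq_constantCoeff_apply, treeKernel, map_sub, coeff_divX_vertexGF]; simp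
  · rw [treeKernel, map_sub, coeff_divX_vertexGF]; simp

theorem one_add_treeGF_mul_invOfUnit : (1 + treeGF) * invOfUnit (1 + treeGF) 1 = 1 :=
  mul_invOfUnit _ _ (by simp [treeGF])

theorem forestKernel_mul : forestKernel * (1 + treeGF) = X := by
  rw [forestKernel, mul_assoc, mul_comm (invOfUnit _ _), one_add_treeGF_mul_invOfUnit, mul_one]

theorem isCompInverse_forestKernel : IsCompInverse forestKernel (compInverse forestKernel) := by
  apply isCompInverse_compInverse
  · simp [forestKernel]
  · rw [forestKernel, show (1 : ℕ) = 0 + 1 from rfl, coeff_succ_X_mul]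
    simp

/-- The inverse `g` of the tree kernel satisfies `g = x + F(g) / g`. -/
theorem compInverse_treeKernel_eq :
    compInverse treeKernel = X + (divX vertexGF).subst (compInverse treeKernel) := by
  obtain ⟨-, h0, h, -⟩ := isCompInverse_treeKernel
  have hs := HasSubst.of_constantCoeff_zero' h0
  have h2 : treeKernel.subst (compInverse treeKernel) =
      compInverse treeKernel - (divX vertexGF).subst (compInverse treeKernel) := by
    conv_lhs => enter [2]; rw [treeKernel]
    rw [subst_sub hs, subst_X hs]
  linear_combination h - h2

theorem X_mul_forestGF : X * forestGF = compInverse forestKernel :=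
  X_mul_divX isCompInverse_forestKernel.2.1

theorem constantCoeff_X_mul_forestGF : constantCoeff (X * forestGF) = 0 := by simp

theorem hasSubst_X_mul_forestGF : HasSubst (X * forestGF) :=
  HasSubst.of_constantCoeff_zero' constantCoeff_X_mul_forestGF

theorem subst_one' {f : PowerSeries (Polynomial ℤ)} (hf : HasSubst f) :
    (1 : PowerSeries (Polynomial ℤ)).subst f = (1 : PowerSeries (Polynomial ℤ)) := by
  rw [← coe_substAlgHom hf, map_one]

/-- `G_forest = 1 + G_tree(x G_forest)`. -/
theorem forestGF_eq : forestGF = 1 + treeGF.subst (X * forestGF) := by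
  have hs := hasSubst_X_mul_forestGF
  have h := isCompInverse_forestKernel.2.2.1
  rw [← X_mul_forestGF] at h
  have h2 := congrArg (subst (X * forestGF)) forestKernel_mul
  rw [subst_mul hs, h, subst_add hs, subst_one' hs, subst_X hs] at h2
  exact (mul_left_cancel₀ X_ne_zero h2).symm

/-- F / x is the geometric series q x ^ 3 / (1 - q ^ 2 x ^ 2). Clearing the denominator leaves a
cubic whose top coefficient q (q + 1) vanishes at q = -1. -/
theorem treeKernel_mul :
    treeKernel * (1 - C (Polynomial.X ^ 2) * X ^ 2) =
      X - C (Polynomial.X ^ 2 + Polynomial.X) * X ^ 3 := by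
  have h : divX vertexGF * (1 - C (Polynomial.X ^ 2) * X ^ 2) = C Polynomial.X * X ^ 3 := by
    ext1 n
    rw [mul_sub, mul_one, map_sub, coeff_divX_vertexGF, mul_left_comm, coeff_C_mul, coeff_C_mul,
      coeff_mul_X_pow', coeff_X_pow, coeff_divX_vertexGF]
    rcases lt_trichotomy n 3 with hn | rfl | hn
    · interval_cases n <;> simp
    · simp [Nat.odd_iff]
    · obtain ⟨m, rfl⟩ : ∃ m, n = m + 2 := ⟨n - 2, by omega⟩
      by_cases ho : Odd m
      · have h3 : 3 ≤ m := by rcases ho with ⟨r, rfl⟩; omega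
        have h3' : 3 ≤ m + 2 := by omega
        have h4 : Odd (m + 2) := by simpa [Nat.odd_add, parity_simps] using ho
        obtain ⟨r, rfl⟩ : ∃ r, m = r + 3 := ⟨m - 3, by omega⟩
        simp [ho, h4]
        ring
      · have h4 : ¬ Odd (m + 2) := by simpa [Nat.odd_add, parity_simps] using ho
        have h5 : m + 2 ≠ 3 := by omega
        simp [ho, h4, h5]
  rw [treeKernel, sub_mul, h, map_add]
  ring

theorem one_sub_X_sq_mul_map_forestGF :
    (1 - X ^ 2) * PowerSeries.map (Polynomial.evalRingHom (-1 : ℤ)) forestGF = 1 := by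
  have hs := hasSubst_X_mul_forestGF
  obtain ⟨-, hg0, hg, -⟩ := isCompInverse_treeKernel
  have hgs := HasSubst.of_constantCoeff_zero' hg0
  -- Through u both inverses are replaced by polynomial relations between Φ and u, so q can be
  -- specialized after all substitutions are done.
  set u : PowerSeries (Polynomial ℤ) := (compInverse treeKernel).subst (X * forestGF) with hu
  have hu0 : constantCoeff u = 0 := by
    rw [hu]
    exact constantCoeff_subst_eq_zero constantCoeff_X_mul_forestGF _ hg0
  have hus := HasSubst.of_constantCoeff_zero' hu0
  have h1 : forestGF = 1 + X * forestGF * u := by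
    conv_lhs => rw [forestGF_eq, treeGF, subst_mul hs, subst_X hs]
  have h2 : treeKernel.subst u = X * forestGF := by
    rw [hu, ← subst_comp_subst_apply hgs hs, hg, subst_X hs]
  have h3 := congrArg (subst u) treeKernel_mul
  have hC (r : Polynomial ℤ) : (C r).subst u = (C r : PowerSeries (Polynomial ℤ)) := subst_C r
  rw [subst_mul hus, h2, subst_sub hus, subst_sub hus, subst_mul hus, subst_mul hus,
    subst_pow hus, subst_pow hus, subst_X hus, hC, hC, subst_one' hus] at h3
  have h1' := congrArg (PowerSeries.map (Polynomial.evalRingHom (-1 : ℤ))) h1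
  have h3' := congrArg (PowerSeries.map (Polynomial.evalRingHom (-1 : ℤ))) h3
  simp only [map_add, map_mul, map_sub, map_pow, map_one, map_X, map_C,
    Polynomial.coe_evalRingHom, Polynomial.eval_X] at h1' h3'
  set p := PowerSeries.map (Polynomial.evalRingHom (-1 : ℤ)) forestGF
  set v := PowerSeries.map (Polynomial.evalRingHom (-1 : ℤ)) u
  -- Here p = 1 + x p v and x p (1 - v ^ 2) = v; replacing x p v by p - 1 in the second relation
  -- gives x p = p v.
  have h4 : p * X = p * v := by
    rw [map_neg, map_one] at h3'
    linear_combination h3' - v * h1'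
  have hp : p ≠ 0 := by
    intro h
    rw [h] at h1'
    simp at h1'
  have hv := mul_left_cancel₀ hp h4
  rw [← hv] at h1'
  linear_combination h1'

theorem coeff_pow_eq_zero {R : Type*} [CommRing R] {f : PowerSeries R} (hf : constantCoeff f = 0)
    {m n : ℕ} (h : n < m) : coeff n (f ^ m) = 0 :=
  X_pow_dvd_iff.1 (pow_dvd_pow_of_dvd (X_dvd_iff.2 hf) m) n h

/-- The equation `g = x + F(g) / g`, coefficient by coefficient. -/
theorem coeff_compInverse_treeKernel (n : ℕ) :
    coeff n (compInverse treeKernel) = (if n = 1 then 1 else 0) +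
      ∑ m ∈ (Finset.range (n + 1)).filter (fun m => Odd m ∧ 3 ≤ m),
        Polynomial.X ^ (m - 2) * coeff n (compInverse treeKernel ^ m) := by
  have h0 := isCompInverse_treeKernel.2.1
  conv_lhs => rw [compInverse_treeKernel_eq]
  rw [map_add, coeff_X, coeff_subst' (HasSubst.of_constantCoeff_zero' h0),
    finsum_eq_sum_of_support_subset (s := Finset.range (n + 1))]
  · rw [Finset.sum_filter]
    congr 1
    refine Finset.sum_congr rfl fun m _ => ?_
    rw [coeff_divX_vertexGF]
    split_ifs <;> simp
  -- Since g has no constant term, g ^ m starts in degree at least m, so only m ≤ n contribute.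
  · intro m hm
    by_contra hlt
    simp only [Finset.coe_range, Set.mem_Iio, not_lt] at hlt
    exact hm (by simp [coeff_pow_eq_zero h0 (show n < m by omega)])

end OGForest

/-! ### Noncrossing tilings -/

/-- Two sets of integers cross: elements of the one and of the other alternate. -/
def SetsCross (B C : Finset ℕ) : Prop :=
  ∃ a b c d : ℕ, a < b ∧ b < c ∧ c < d ∧ a ∈ B ∧ b ∈ C ∧ c ∈ B ∧ d ∈ C

/-- The pieces in `Q`, where the piece `T` occupies the set `e T`, form a noncrossing partition
of `S`. -/
structure NCTiling {τ : Type} (e : τ → Finset ℕ) (S : Finset ℕ) (Q : Finset τ) : Prop where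
  mem_iff : ∀ i, i ∈ S ↔ ∃ T ∈ Q, i ∈ e T
  eq_of_mem : ∀ T ∈ Q, ∀ T' ∈ Q, ∀ i, i ∈ e T → i ∈ e T' → T = T'
  not_cross : ∀ T ∈ Q, ∀ T' ∈ Q, T ≠ T' → ¬ SetsCross (e T) (e T')

/-- No piece of `Q` crosses the set `B`. -/
def Avoids {τ : Type} (e : τ → Finset ℕ) (B : Finset ℕ) (Q : Finset τ) : Prop :=
  ∀ T ∈ Q, ¬ SetsCross B (e T) ∧ ¬ SetsCross (e T) B

namespace NCTiling

variable {τ : Type} {e : τ → Finset ℕ} {S B : Finset ℕ} {Q : Finset τ}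

theorem subset_of_mem (h : NCTiling e S Q) {T : τ} (hT : T ∈ Q) : e T ⊆ S :=
  fun i hi => (h.mem_iff i).2 ⟨T, hT, hi⟩

theorem erase [DecidableEq τ] (h : NCTiling e S Q) {T : τ} (hT : T ∈ Q) :
    NCTiling e (S \ e T) (Q.erase T) ∧ Avoids e (e T) (Q.erase T) := by
  obtain ⟨h1, h2, h3⟩ := h
  refine ⟨⟨fun i => ?_, ?_, ?_⟩, fun T' hT' => ?_⟩
  · rw [Finset.mem_sdiff, h1]
    constructor
    · rintro ⟨⟨T', hT', hi⟩, hn⟩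
      exact ⟨T', Finset.mem_erase.2 ⟨by rintro rfl; exact hn hi, hT'⟩, hi⟩
    · rintro ⟨T', hT', hi⟩
      rw [Finset.mem_erase] at hT'
      exact ⟨⟨T', hT'.2, hi⟩, fun hi' => hT'.1 (h2 _ hT'.2 _ hT _ hi hi')⟩
  · exact fun T₁ h₁ T₂ h₂ => h2 _ (Finset.mem_of_mem_erase h₁) _ (Finset.mem_of_mem_erase h₂)
  · exact fun T₁ h₁ T₂ h₂ => h3 _ (Finset.mem_of_mem_erase h₁) _ (Finset.mem_of_mem_erase h₂)
  · rw [Finset.mem_erase] at hT'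
    exact ⟨h3 _ hT _ hT'.2 hT'.1.symm, h3 _ hT'.2 _ hT hT'.1⟩

theorem insert [DecidableEq τ] {T : τ} (hTS : e T ⊆ S) (h : NCTiling e (S \ e T) Q)
    (ha : Avoids e (e T) Q) : NCTiling e S (insert T Q) := by
  obtain ⟨h1, h2, h3⟩ := h
  have h4 : ∀ T' ∈ Q, ∀ i ∈ e T', i ∉ e T := fun T' hT' i hi =>
    (Finset.mem_sdiff.1 ((h1 i).2 ⟨T', hT', hi⟩)).2
  refine ⟨fun i => ?_, ?_, ?_⟩
  · have h5 := h1 i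
    have h6 := @hTS i
    simp only [Finset.mem_sdiff, Finset.mem_insert, exists_eq_or_imp] at h5 ⊢
    rw [← h5]
    tauto
  · intro T₁ hT₁ T₂ hT₂ i hi hi'
    rw [Finset.mem_insert] at hT₁ hT₂
    rcases hT₁ with rfl | hT₁ <;> rcases hT₂ with rfl | hT₂
    · rfl
    · exact absurd hi (h4 _ hT₂ _ hi')
    · exact absurd hi' (h4 _ hT₁ _ hi)
    · exact h2 _ hT₁ _ hT₂ _ hi hi'
  · intro T₁ hT₁ T₂ hT₂ hne
    rw [Finset.mem_insert] at hT₁ hT₂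
    rcases hT₁ with rfl | hT₁ <;> rcases hT₂ with rfl | hT₂
    · exact absurd rfl hne
    · exact (ha _ hT₂).1
    · exact (ha _ hT₁).2
    · exact h3 _ hT₁ _ hT₂ hne

/-- Pieces that avoid a set containing `a` and `b` lie on one side of `b`. -/
theorem lt_or_gt_of_avoids {a b : ℕ} (hab : a < b) (ha : a ∈ B) (hb : b ∈ B) (hQ : Avoids e B Q)
    {T : τ} (hT : T ∈ Q) (haT : ∀ i ∈ e T, a < i) (hbT : b ∉ e T) :
    (∀ i ∈ e T, i < b) ∨ ∀ i ∈ e T, b < i := by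
  by_contra! h
  obtain ⟨⟨y, hy, hby⟩, x, hx, hxb⟩ := h
  have hy' : b < y := lt_of_le_of_ne hby (by rintro rfl; exact hbT hy)
  have hx' : x < b := lt_of_le_of_ne hxb (by rintro rfl; exact hbT hx)
  exact (hQ T hT).1 ⟨a, x, b, y, haT x hx, hx', hy', ha, hx, hb, hy⟩

end NCTiling

/-! ### Recursions for weighted tilings of intervals -/

section Weights

open Finset

variable {τ : Type} [Fintype τ] {R : Type} [CommRing R] (e : τ → Finset ℕ) (wt : τ → R)

open Classical in
/-- The total weight of the noncrossing tilings of `S`. -/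
noncomputable def tilingSum (S : Finset ℕ) : R :=
  ∑ Q ∈ univ.filter (fun Q : Finset τ => NCTiling e S Q), ∏ T ∈ Q, wt T

open Classical in
/-- The total weight of the noncrossing tilings of `S \ B` that do not cross `B`. -/
noncomputable def avoidingSum (B S : Finset ℕ) : R :=
  ∑ Q ∈ univ.filter (fun Q : Finset τ => NCTiling e (S \ B) Q ∧ Avoids e B Q), ∏ T ∈ Q, wt T

open Classical in
-- Exactly one piece of a tiling contains `a`; removing it leaves a tiling of the complement that
-- does not cross it, and this is reversible.
theorem tilingSum_eq_sum_piece {S : Finset ℕ} {a : ℕ} (ha : a ∈ S) :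
    tilingSum e wt S =
      ∑ T ∈ univ.filter (fun T => e T ⊆ S ∧ a ∈ e T), wt T * avoidingSum e wt (e T) S := by
  simp only [avoidingSum, mul_sum]
  rw [sum_sigma', tilingSum]
  symm
  have hnot : ∀ x : (_ : τ) × Finset τ, a ∈ e x.1 → NCTiling e (S \ e x.1) x.2 → x.1 ∉ x.2 := by
    intro x hx h hmem
    exact (mem_sdiff.1 ((h.mem_iff a).2 ⟨_, hmem, hx⟩)).2 hx
  refine sum_bij (fun x _ => insert x.1 x.2) ?_ ?_ ?_ ?_
  · rintro ⟨T, Q⟩ h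
    simp only [mem_sigma, mem_filter, mem_univ, true_and] at h ⊢
    exact NCTiling.insert h.1.1 h.2.1 h.2.2
  · rintro ⟨T, Q⟩ h ⟨T', Q'⟩ h' heq
    simp only [mem_sigma, mem_filter, mem_univ, true_and] at h h' heq
    have hn : T ∉ Q := hnot ⟨T, Q⟩ h.1.2 h.2.1
    have hn' : T' ∉ Q' := hnot ⟨T', Q'⟩ h'.1.2 h'.2.1
    have ht := NCTiling.insert h.1.1 h.2.1 h.2.2
    have hTT : T = T' := ht.eq_of_mem _ (mem_insert_self _ _) _
      (heq ▸ mem_insert_self _ _) a h.1.2 h'.1.2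
    subst hTT
    have : Q = Q' := by rw [← erase_insert hn, heq, erase_insert hn']
    rw [this]
  · intro Q h
    simp only [mem_filter, mem_univ, true_and] at h
    obtain ⟨T, hT, haT⟩ := (h.mem_iff a).1 ha
    refine ⟨⟨T, Q.erase T⟩, ?_, insert_erase hT⟩
    simp only [mem_sigma, mem_filter, mem_univ, true_and]
    exact ⟨⟨h.subset_of_mem hT, haT⟩, h.erase hT⟩
  · rintro ⟨T, Q⟩ h
    simp only [mem_sigma, mem_filter, mem_univ, true_and] at h
    rw [prod_insert (hnot ⟨T, Q⟩ h.1.2 h.2.1)]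

/-- A crossing needs two points of each set, so nothing crosses a singleton. -/
theorem avoidingSum_singleton (a n : ℕ) :
    avoidingSum e wt {a} (Ico a n) = tilingSum e wt (Ico (a + 1) n) := by
  classical
  have hS : Ico a n \ {a} = Ico (a + 1) n := by
    ext i; simp only [mem_sdiff, mem_Ico, mem_singleton]; omega
  rw [avoidingSum, tilingSum, hS]
  congr 1
  refine filter_congr fun Q _ => and_iff_left_of_imp fun h T hT => ?_
  have hsub := h.subset_of_mem hT
  constructor
  · rintro ⟨x, y, z, w, hxy, hyz, -, hx, -, hz, -⟩
    simp only [mem_singleton] at hx hz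
    omega
  · rintro ⟨x, y, z, w, hxy, hyz, hzw, hx, hy, hz, hw⟩
    simp only [mem_singleton] at hy hw
    omega

/-- No piece can straddle `b` without crossing `{a, b}`, so the pieces left of `b` tile the gap
freely and the others only see `B`. Nonempty pieces make the splitting unique: an empty one would
count as lying on the left. -/
theorem avoidingSum_insert (hne : ∀ T, (e T).Nonempty) {a b n : ℕ} {B : Finset ℕ} (hab : a < b)
    (hb : b ∈ B) (hB : B ⊆ Ico b n) :
    avoidingSum e wt (insert a B) (Ico a n) =
      tilingSum e wt (Ico (a + 1) b) * avoidingSum e wt B (Ico b n) := by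
  classical
  have hBI : ∀ i ∈ B, b ≤ i ∧ i < n := fun i hi => mem_Ico.1 (hB hi)
  rw [avoidingSum, avoidingSum, tilingSum, sum_mul_sum, ← sum_product']
  symm
  have hleft : ∀ {Q}, NCTiling e (Ico (a + 1) b) Q → ∀ T ∈ Q, ∀ i ∈ e T, a < i ∧ i < b := by
    intro Q h T hT i hi
    have := mem_Ico.1 (h.subset_of_mem hT hi)
    omega
  have hright : ∀ {Q}, NCTiling e (Ico b n \ B) Q →
      ∀ T ∈ Q, ∀ i ∈ e T, b < i ∧ i < n ∧ i ∉ B := by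
    intro Q h T hT i hi
    have h1 := mem_sdiff.1 (h.subset_of_mem hT hi)
    have h2 := mem_Ico.1 h1.1
    have h3 : i ≠ b := by rintro rfl; exact h1.2 hb
    exact ⟨by omega, h2.2, h1.2⟩
  refine sum_bij' (fun x _ => x.1 ∪ x.2)
    (fun Q _ => (Q.filter (fun T => ∀ i ∈ e T, i < b), Q.filter (fun T => ¬ ∀ i ∈ e T, i < b)))
    ?_ ?_ ?_ ?_ ?_
  · rintro ⟨Q₁, Q₂⟩ h
    simp only [mem_product, mem_filter, mem_univ, true_and] at h ⊢
    obtain ⟨h1, h2, h3⟩ := h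
    have hl := hleft h1
    have hr := hright h2
    refine ⟨⟨fun i => ?_, ?_, ?_⟩, ?_⟩
    · simp only [mem_union, or_and_right, exists_or, ← h1.mem_iff, ← h2.mem_iff, mem_sdiff,
        mem_insert, mem_Ico]
      have h4 := hBI i
      have h5 := hBI b hb
      by_cases hib : i = b
      · subst hib; grind
      · grind
    · intro T hT T' hT' i hi hi'
      rw [mem_union] at hT hT'
      rcases hT with hT | hT <;> rcases hT' with hT' | hT'
      · exact h1.eq_of_mem _ hT _ hT' _ hi hi'
      · have := hl _ hT _ hi; have := hr _ hT' _ hi'; omega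
      · have := hr _ hT _ hi; have := hl _ hT' _ hi'; omega
      · exact h2.eq_of_mem _ hT _ hT' _ hi hi'
    · intro T hT T' hT' hTT
      rw [mem_union] at hT hT'
      rcases hT with hT | hT <;> rcases hT' with hT' | hT'
      · exact h1.not_cross _ hT _ hT' hTT
      · rintro ⟨x, y, z, w, hxy, hyz, hzw, hx, hy, hz, hw⟩
        have := hl _ hT _ hz; have := hr _ hT' _ hy; omega
      · rintro ⟨x, y, z, w, hxy, hyz, hzw, hx, hy, hz, hw⟩
        have := hr _ hT _ hx; have := hl _ hT' _ hy; omega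
      · exact h2.not_cross _ hT _ hT' hTT
    · intro T hT
      rw [mem_union] at hT
      rcases hT with hT | hT
      · constructor
        · rintro ⟨x, y, z, w, hxy, hyz, hzw, hx, hy, hz, hw⟩
          have h4 := hl _ hT _ hy; have h5 := hl _ hT _ hw
          rcases mem_insert.1 hz with hz | hz
          · omega
          · have := hBI _ hz; omega
        · rintro ⟨x, y, z, w, hxy, hyz, hzw, hx, hy, hz, hw⟩
          have h4 := hl _ hT _ hx; have h5 := hl _ hT _ hz
          rcases mem_insert.1 hy with hz | hz
          · omega
          · have := hBI _ hz; omega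
      · constructor
        · rintro ⟨x, y, z, w, hxy, hyz, hzw, hx, hy, hz, hw⟩
          have h4 := hr _ hT _ hy
          have hz' : z ∈ B := mem_of_mem_insert_of_ne hz (by omega)
          -- A crossing that starts at `a` may start at `b` instead, because this piece lies beyond
          -- `b`.
          rcases mem_insert.1 hx with hx | hx
          · exact (h3 _ hT).1 ⟨b, y, z, w, h4.1, hyz, hzw, hb, hy, hz', hw⟩
          · exact (h3 _ hT).1 ⟨x, y, z, w, hxy, hyz, hzw, hx, hy, hz', hw⟩
        · rintro ⟨x, y, z, w, hxy, hyz, hzw, hx, hy, hz, hw⟩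
          have h4 := hr _ hT _ hx
          exact (h3 _ hT).2 ⟨x, y, z, w, hxy, hyz, hzw, hx,
            mem_of_mem_insert_of_ne hy (by omega), hz, mem_of_mem_insert_of_ne hw (by omega)⟩
  · intro Q h
    simp only [mem_product, mem_filter, mem_univ, true_and] at h ⊢
    obtain ⟨h1, h2⟩ := h
    have hin : ∀ T ∈ Q, ∀ i ∈ e T, a < i ∧ i < n ∧ i ∉ B := by
      intro T hT i hi
      have h3 := mem_sdiff.1 (h1.subset_of_mem hT hi)
      have h4 := mem_Ico.1 h3.1
      have h5 : i ≠ a := by rintro rfl; exact h3.2 (mem_insert_self _ _)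
      exact ⟨by omega, h4.2, fun h => h3.2 (mem_insert_of_mem h)⟩
    have hside : ∀ T ∈ Q, (∀ i ∈ e T, i < b) ∨ ∀ i ∈ e T, b < i := fun T hT =>
      NCTiling.lt_or_gt_of_avoids hab (mem_insert_self a B) (mem_insert_of_mem hb) h2 hT
        (fun i hi => (hin T hT i hi).1) (fun hbT => (hin T hT b hbT).2.2 hb)
    refine ⟨⟨fun i => ?_, ?_, ?_⟩, ⟨fun i => ?_, ?_, ?_⟩, ?_⟩
    · simp only [mem_filter]
      constructor
      · intro hi
        rw [mem_Ico] at hi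
        have hiB : i ∉ insert a B := by
          intro h
          rcases mem_insert.1 h with h | h
          · omega
          · have := hBI _ h; omega
        have hin' : i < n := by have := hBI b hb; omega
        obtain ⟨T, hT, hiT⟩ := (h1.mem_iff i).1 (mem_sdiff.2 ⟨mem_Ico.2 ⟨by omega, hin'⟩, hiB⟩)
        refine ⟨T, ⟨hT, (hside T hT).resolve_right fun h => ?_⟩, hiT⟩
        have := h i hiT; omega
      · rintro ⟨T, ⟨hT, hlt⟩, hi⟩
        exact mem_Ico.2 ⟨(hin T hT i hi).1, hlt i hi⟩
    · exact fun T hT T' hT' => h1.eq_of_mem T (mem_filter.1 hT).1 T' (mem_filter.1 hT').1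
    · exact fun T hT T' hT' => h1.not_cross T (mem_filter.1 hT).1 T' (mem_filter.1 hT').1
    · simp only [mem_filter]
      constructor
      · intro hi
        rw [mem_sdiff, mem_Ico] at hi
        have hiB : i ∉ insert a B := by
          intro h
          rcases mem_insert.1 h with h | h
          · omega
          · exact hi.2 h
        obtain ⟨T, hT, hiT⟩ := (h1.mem_iff i).1
          (mem_sdiff.2 ⟨mem_Ico.2 ⟨by omega, hi.1.2⟩, hiB⟩)
        refine ⟨T, ⟨hT, fun h => ?_⟩, hiT⟩
        have := h i hiT; omega
      · rintro ⟨T, ⟨hT, hlt⟩, hi⟩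
        have h3 := (hside T hT).resolve_left hlt i hi
        have h4 := hin T hT i hi
        exact mem_sdiff.2 ⟨mem_Ico.2 ⟨h3.le, h4.2.1⟩, h4.2.2⟩
    · exact fun T hT T' hT' => h1.eq_of_mem T (mem_filter.1 hT).1 T' (mem_filter.1 hT').1
    · exact fun T hT T' hT' => h1.not_cross T (mem_filter.1 hT).1 T' (mem_filter.1 hT').1
    · intro T hT
      have h3 := h2 T (mem_filter.1 hT).1
      constructor
      · rintro ⟨x, y, z, w, hxy, hyz, hzw, hx, hy, hz, hw⟩
        exact h3.1 ⟨x, y, z, w, hxy, hyz, hzw, mem_insert_of_mem hx, hy, mem_insert_of_mem hz, hw⟩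
      · rintro ⟨x, y, z, w, hxy, hyz, hzw, hx, hy, hz, hw⟩
        exact h3.2 ⟨x, y, z, w, hxy, hyz, hzw, hx, mem_insert_of_mem hy, hz, mem_insert_of_mem hw⟩
  · rintro ⟨Q₁, Q₂⟩ h
    simp only [mem_product, mem_filter, mem_univ, true_and] at h ⊢
    have hl := hleft h.1
    have hr := hright h.2.1
    have h1 : ∀ T ∈ Q₁, ∀ i ∈ e T, i < b := fun T hT i hi => (hl T hT i hi).2
    have h2 : ∀ T ∈ Q₂, ¬ ∀ i ∈ e T, i < b := by
      intro T hT hlt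
      obtain ⟨i, hi⟩ := hne T
      have := hlt i hi; have := hr T hT i hi; omega
    rw [filter_union, filter_union, filter_true_of_mem h1, filter_false_of_mem h2,
      filter_true_of_mem h2, filter_false_of_mem (fun T hT => not_not.2 (h1 T hT)),
      union_empty, empty_union]
  · intro Q _
    exact filter_union_filter_not_eq _ _
  · rintro ⟨Q₁, Q₂⟩ h
    simp only [mem_product, mem_filter, mem_univ, true_and] at h ⊢
    rw [prod_union]
    rw [disjoint_left]
    intro T hT hT'
    obtain ⟨i, hi⟩ := hne T
    have := hleft h.1 T hT i hi; have := hright h.2.1 T hT' i hi; omega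

/-- Sum over the blocks `B` with least element `a`, where `B` gets the weight of a block with `j`
further elements. -/
noncomputable def blockSum (t : ℕ → R) (j a n : ℕ) : R :=
  ∑ B ∈ (Ico a n).powerset.filter (fun B => a ∈ B),
    t (B.card + j) * avoidingSum e wt B (Ico a n)

/-- The pieces through `a` are grouped by the set they occupy, on which alone the remaining factor
depends. -/
theorem tilingSum_eq_blockSum {t : ℕ → R} {N : ℕ} [DecidableEq τ]
    (ht : ∀ B : Finset ℕ, B.Nonempty → B ⊆ range N → ∑ T ∈ univ.filter (fun T => e T = B), wt T =
      t B.card) {a n : ℕ} (han : a < n) (hn : n ≤ N) :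
    tilingSum e wt (Ico a n) = blockSum e wt t 0 a n := by
  classical
  rw [tilingSum_eq_sum_piece e wt (mem_Ico.2 ⟨le_rfl, han⟩), blockSum]
  rw [← sum_fiberwise_of_maps_to (g := e) (t := (Ico a n).powerset.filter (fun B => a ∈ B))]
  · refine sum_congr rfl fun B hB => ?_
    rw [mem_filter, mem_powerset] at hB
    rw [add_zero, ← ht B ⟨a, hB.2⟩ (fun i hi => mem_range.2
      ((mem_Ico.1 (hB.1 hi)).2.trans_le hn)), sum_mul, filter_filter]
    refine sum_congr ?_ fun T hT => ?_
    · refine filter_congr fun T _ => ⟨fun h => h.2, fun h => ⟨?_, h⟩⟩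
      rw [h]; exact hB
    · rw [(mem_filter.1 hT).2]
  · intro T hT
    simp only [mem_filter, mem_univ, true_and, mem_powerset] at hT ⊢
    exact hT

/-- The first term is the block `{a}`. Otherwise `b` is the second least element of the block: the
gap before it is tiled freely, and the index `j + 1` remembers that `a` has been removed. -/
theorem blockSum_eq (hne : ∀ T, (e T).Nonempty) (t : ℕ → R) (j : ℕ) {a n : ℕ} (han : a < n) :
    blockSum e wt t j a n = t (1 + j) * tilingSum e wt (Ico (a + 1) n) +
      ∑ b ∈ Ico (a + 1) n, tilingSum e wt (Ico (a + 1) b) * blockSum e wt t (j + 1) b n := by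
  classical
  rw [blockSum, ← sum_erase_add (a := {a})]
  swap
  · simp [han]
  rw [add_comm, avoidingSum_singleton, card_singleton]
  congr 1
  simp only [blockSum, mul_sum]
  rw [sum_sigma']
  symm
  have hx : ∀ x : (_ : ℕ) × Finset ℕ, x ∈ (Ico (a + 1) n).sigma
      (fun b => (Ico b n).powerset.filter (fun B => b ∈ B)) →
      a < x.1 ∧ x.1 ∈ x.2 ∧ x.2 ⊆ Ico x.1 n ∧ a ∉ x.2 := by
    rintro ⟨b, B⟩ h
    simp only [mem_sigma, mem_filter, mem_powerset, mem_Ico] at h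
    refine ⟨h.1.1, h.2.2, h.2.1, fun haB => ?_⟩
    have := mem_Ico.1 (h.2.1 haB)
    have := h.1.1
    omega
  refine sum_bij (fun x _ => insert a x.2) ?_ ?_ ?_ ?_
  · intro x h
    obtain ⟨h1, h2, h3, h4⟩ := hx x h
    simp only [mem_erase, mem_filter, mem_powerset, mem_insert_self, and_true]
    refine ⟨fun heq => ?_, fun i hi => ?_⟩
    · have : x.1 ∈ ({a} : Finset ℕ) := heq ▸ mem_insert_of_mem h2
      rw [mem_singleton] at this; omega
    · rcases mem_insert.1 hi with rfl | hi
      · simp [han]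
      · have := mem_Ico.1 (h3 hi)
        exact mem_Ico.2 (by omega)
  · rintro ⟨b, B⟩ h ⟨b', B'⟩ h' heq
    obtain ⟨h1, h2, h3, h4⟩ := hx _ h
    obtain ⟨h1', h2', h3', h4'⟩ := hx _ h'
    simp only at h1 h2 h3 h4 h1' h2' h3' h4' heq
    have hBB : B = B' := by
      rw [← erase_insert h4, ← erase_insert h4']
      exact congrArg (fun s => s.erase a) heq
    subst hBB
    have := mem_Ico.1 (h3 h2')
    have := mem_Ico.1 (h3' h2)
    have : b = b' := by omega
    rw [this]
  · intro B h
    simp only [mem_erase, mem_filter, mem_powerset] at h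
    obtain ⟨h1, h2, h3⟩ := h
    have hne' : (B.erase a).Nonempty := by
      rw [nonempty_iff_ne_empty]
      intro h0
      rcases erase_eq_empty_iff _ _ |>.1 h0 with h0 | h0
      · simp [h0] at h3
      · exact h1 h0
    have hmin := min'_mem _ hne'
    rw [mem_erase] at hmin
    have h4 := mem_Ico.1 (h2 hmin.2)
    refine ⟨⟨(B.erase a).min' hne', B.erase a⟩, ?_, insert_erase h3⟩
    simp only [mem_sigma, mem_filter, mem_powerset, min'_mem, and_true]
    refine ⟨mem_Ico.2 (by omega), fun i hi => mem_Ico.2 ⟨min'_le _ _ hi, ?_⟩⟩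
    exact (mem_Ico.1 (h2 (mem_of_mem_erase hi))).2
  · rintro ⟨b, B⟩ h
    obtain ⟨h1, h2, h3, h4⟩ := hx _ h
    rw [avoidingSum_insert e wt hne h1 h2 h3, card_insert_of_notMem h4,
      show B.card + 1 + j = B.card + (j + 1) by ring]
    ring

end Weights

/-! ### From the recursions to power series -/

section Series

open PowerSeries Finset

variable {R : Type} [CommRing R]

/-- The part of positive degree of the `j`-fold left shift of the sequence `t`. -/
noncomputable def shiftSeries (t : ℕ → R) (j : ℕ) : PowerSeries R :=
  PowerSeries.mk fun i => if i = 0 then 0 else t (i + j)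

theorem shiftSeries_eq (t : ℕ → R) (j : ℕ) :
    shiftSeries t j = X * (C (t (1 + j)) + shiftSeries t (j + 1)) := by
  ext n
  cases n with
  | zero => simp [shiftSeries]
  | succ n =>
    rw [coeff_succ_X_mul]
    cases n with
    | zero => simp [shiftSeries]
    | succ n =>
      rw [map_add, coeff_C]
      simp only [shiftSeries, coeff_mk]
      simp [add_comm, add_left_comm]

/-- This is `blockSum_eq` in terms of series: X stands for the least element of the block, Φ for the
gap after it, and the bracket for ending the block or continuing it. -/
theorem subst_shiftSeries (t : ℕ → R) (j : ℕ) (Φ : PowerSeries R) :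
    (shiftSeries t j).subst (X * Φ) =
      X * (Φ * (C (t (1 + j)) + (shiftSeries t (j + 1)).subst (X * Φ))) := by
  have hs : HasSubst (X * Φ) := HasSubst.of_constantCoeff_zero' (by simp)
  have hC (r : R) : (C r).subst (X * Φ) = (C r : PowerSeries R) := subst_C r
  conv_lhs => rw [shiftSeries_eq, subst_mul hs, subst_add hs, subst_X hs, hC]
  rw [mul_assoc]

variable {τ : Type} [Fintype τ] (e : τ → Finset ℕ) (wt : τ → R)

/-- Noncrossing tilings of an interval are counted by the solution of `Φ = 1 + t(x Φ)`, where
`t` counts the pieces by the size of the set they occupy. -/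
theorem tilingSum_Ico [DecidableEq τ] (hne : ∀ T, (e T).Nonempty) {t : ℕ → R} {N : ℕ}
    (ht : ∀ B : Finset ℕ, B.Nonempty → B ⊆ range N →
      ∑ T ∈ univ.filter (fun T => e T = B), wt T = t B.card)
    {Φ : PowerSeries R} (hΦ : Φ = 1 + (shiftSeries t 0).subst (X * Φ)) (d : ℕ) :
    ∀ a n, n = a + d → n ≤ N → tilingSum e wt (Ico a n) = coeff d Φ ∧
      (0 < d → ∀ j, blockSum e wt t j a n = coeff d ((shiftSeries t j).subst (X * Φ))) := by
  classical
  induction d using Nat.strong_induction_on with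
  | _ d ih =>
    intro a n hn hnN
    cases d with
    | zero =>
      refine ⟨?_, fun h => absurd h (lt_irrefl _)⟩
      have hΦ0 : coeff 0 Φ = 1 := by
        rw [hΦ, subst_shiftSeries, map_add, coeff_zero_X_mul, add_zero, coeff_zero_one]
      have hS : Ico a n = ∅ := by simp [hn]
      rw [hΦ0, hS, tilingSum, sum_eq_single_of_mem ∅]
      · simp
      · rw [mem_filter]
        exact ⟨mem_univ _, by simp, by simp, by simp⟩
      · intro Q hQ hQ'
        obtain ⟨T, hT⟩ := nonempty_iff_ne_empty.2 hQ'
        obtain ⟨i, hi⟩ := hne T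
        exact absurd (((mem_filter.1 hQ).2.mem_iff i).2 ⟨T, hT, hi⟩) (by simp)
    | succ d =>
      have hblock : ∀ j, blockSum e wt t j a n =
          coeff (d + 1) ((shiftSeries t j).subst (X * Φ)) := by
        intro j
        rw [blockSum_eq e wt hne t j (by omega), subst_shiftSeries, coeff_succ_X_mul, mul_add,
          map_add, coeff_mul_C, coeff_mul, (ih d (by omega) (a + 1) n (by omega) hnN).1, mul_comm]
        congr 1
        rw [Nat.sum_antidiagonal_eq_sum_range_succ_mk, sum_range_succ, sum_Ico_eq_sum_range,
          show n - (a + 1) = d by omega]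
        -- The convolution has one term more than the recursion, namely `b = n`; it vanishes because
        -- the shifted series has no constant term.
        have h0 : coeff (d - d) ((shiftSeries t (j + 1)).subst (X * Φ)) = 0 := by
          rw [subst_shiftSeries, Nat.sub_self, coeff_zero_X_mul]
        rw [h0, mul_zero, add_zero]
        refine sum_congr rfl fun p hp => ?_
        rw [mem_range] at hp
        rw [(ih p (by omega) (a + 1) (a + 1 + p) rfl (by omega)).1,
          (ih (d - p) (by omega) (a + 1 + p) n (by omega) hnN).2 (by omega)]
      refine ⟨?_, fun _ => hblock⟩
      rw [tilingSum_eq_blockSum e wt ht (by omega) hnN, hblock]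
      conv_rhs => rw [hΦ]
      rw [map_add, coeff_one, if_neg (by omega), zero_add]

end Series

/-! ### Counting planted trees with prescribed leaves -/

namespace PlaneTree

open PowerSeries

variable {α : Type}

/-- All internal vertices have even degree at least `4`. -/
def Admissible (t : PlaneTree α) : Prop := ∀ d ∈ t.degrees, Even d ∧ 4 ≤ d

/-- The sum of `deg v - 3` over the internal vertices `v`. -/
def excess (t : PlaneTree α) : ℕ := (t.degrees.map fun d => d - 3).sum

/-- The leaf labels of a sequence of trees. -/
def tupleLeaves {m : ℕ} (c : Fin m → PlaneTree α) : List α :=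
  (List.ofFn fun i => leaves (c i)).flatten

theorem leaves_node (m : ℕ) (c : Fin m → PlaneTree α) : (node m c).leaves = tupleLeaves c := by
  rw [leaves, tupleLeaves]

theorem tupleLeaves_cons {m : ℕ} (t : PlaneTree α) (c : Fin m → PlaneTree α) :
    tupleLeaves (Fin.cons t c : Fin (m + 1) → PlaneTree α) = t.leaves ++ tupleLeaves c := by
  simp [tupleLeaves, List.ofFn_succ]

theorem admissible_leaf (a : α) : (leaf a).Admissible := by simp [Admissible, degrees]

theorem excess_leaf (a : α) : (leaf a).excess = 0 := by simp [excess, degrees]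

theorem admissible_node (m : ℕ) (c : Fin m → PlaneTree α) :
    (node m c).Admissible ↔ (Odd m ∧ 3 ≤ m) ∧ ∀ i, (c i).Admissible := by
  simp only [Admissible, degrees, List.mem_cons, forall_eq_or_imp, List.mem_flatten,
    List.mem_ofFn]
  refine and_congr ?_ ⟨fun h i d hd => h d ⟨_, ⟨i, rfl⟩, hd⟩, ?_⟩
  · rw [Nat.even_add_one, Nat.not_even_iff_odd]
    exact and_congr_right fun _ => by omega
  · rintro h d ⟨_, ⟨i, rfl⟩, hd⟩
    exact h i d hd

theorem excess_node (m : ℕ) (c : Fin m → PlaneTree α) :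
    (node m c).excess = (m - 2) + ∑ i, (c i).excess := by
  simp only [excess, degrees, List.map_cons, List.sum_cons, List.map_flatten, List.sum_flatten,
    List.map_ofFn, List.sum_ofFn]
  rfl

theorem Admissible.leaves_ne_nil {t : PlaneTree α} (h : t.Admissible) : t.leaves ≠ [] := by
  induction t with
  | leaf a => simp [leaves]
  | node m c ih =>
    rw [admissible_node] at h
    intro h0
    have h3 := h.1.2
    rw [leaves, List.flatten_eq_nil_iff] at h0
    exact ih ⟨0, by omega⟩ (h.2 _) (h0 _ (List.mem_ofFn.2 ⟨_, rfl⟩))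

theorem le_length_tupleLeaves {m : ℕ} {c : Fin m → PlaneTree α} (h : ∀ i, (c i).Admissible) :
    m ≤ (tupleLeaves c).length := by
  induction m with
  | zero => simp
  | succ m ih =>
    rw [← Fin.cons_self_tail c, tupleLeaves_cons, List.length_append]
    have h1 := ih (c := Fin.tail c) fun i => h i.succ
    have h2 := List.length_pos_iff.2 (h 0).leaves_ne_nil
    omega

/-- If `g` counts the admissible trees with fewer than `n` leaves, then `g ^ m` counts the
sequences of `m` admissible trees with leaves `l`, where `l` has length less than `n`, or `n` in
case `2 ≤ m`. -/
theorem exists_tuples_eq_coeff {g : PowerSeries (Polynomial ℤ)} (hg : constantCoeff g = 0) {n : ℕ}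
    (ih : ∀ l : List α, l.length < n → ∃ s : Finset (PlaneTree α),
      (∀ t, t ∈ s ↔ t.leaves = l ∧ t.Admissible) ∧
      ∑ t ∈ s, (Polynomial.X : Polynomial ℤ) ^ t.excess = coeff l.length g) (m : ℕ) :
    ∀ l : List α, l.length < n ∨ l.length = n ∧ 2 ≤ m →
      ∃ s : Finset (Fin m → PlaneTree α),
        (∀ c, c ∈ s ↔ tupleLeaves c = l ∧ ∀ i, (c i).Admissible) ∧
        ∑ c ∈ s, (Polynomial.X : Polynomial ℤ) ^ (∑ i, (c i).excess) =
          coeff l.length (g ^ m) := by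
  classical
  induction m with
  | zero =>
    intro l _
    refine ⟨if l = [] then Finset.univ else ∅, fun c => ?_, ?_⟩
    · split_ifs with h
      · simpa [h, tupleLeaves] using Subsingleton.elim _ _
      · simpa [tupleLeaves] using Ne.symm h
    · split_ifs with h
      · simp [h]
      · simp [coeff_one, h]
  | succ m ihm =>
    intro l hl
    have hsplit : ∀ p : ℕ × ℕ, p ∈ Finset.HasAntidiagonal.antidiagonal l.length →
        ∃ s : Finset (PlaneTree α × (Fin m → PlaneTree α)),
          (∀ x, x ∈ s ↔ (x.1.leaves = l.take p.1 ∧ x.1.Admissible) ∧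
            (tupleLeaves x.2 = l.drop p.1 ∧ ∀ i, (x.2 i).Admissible)) ∧
          ∑ x ∈ s, (Polynomial.X : Polynomial ℤ) ^ (x.1.excess + ∑ i, (x.2 i).excess) =
            coeff p.1 g * coeff p.2 (g ^ m) := by
      rintro ⟨i, j⟩ hp
      rw [Finset.HasAntidiagonal.mem_antidiagonal] at hp
      simp only at hp ⊢
      -- Every admissible tree has a leaf, so empty prefixes, and empty suffixes shared by at least
      -- one tree, contribute nothing. In the remaining cases both parts are short enough for the
      -- two induction hypotheses.
      rcases Nat.eq_zero_or_pos i with rfl | hi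
      · refine ⟨∅, fun x => ?_, by simp [hg]⟩
        simp only [Finset.notMem_empty, false_iff, List.take_zero]
        exact fun h => h.1.2.leaves_ne_nil h.1.1
      by_cases hj : j = 0 ∧ 1 ≤ m
      · obtain ⟨rfl, hm⟩ := hj
        refine ⟨∅, fun x => ?_, ?_⟩
        · simp only [Finset.notMem_empty, false_iff]
          intro h
          have h1 := le_length_tupleLeaves h.2.2
          rw [h.2.1, List.length_drop] at h1
          omega
        · rw [OGForest.coeff_pow_eq_zero hg hm, Finset.sum_empty, mul_zero]
      · obtain ⟨s₁, h₁, h₁'⟩ := ih (l.take i) (by rw [List.length_take]; omega)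
        obtain ⟨s₂, h₂, h₂'⟩ := ihm (l.drop i) (by rw [List.length_drop]; omega)
        refine ⟨s₁ ×ˢ s₂, fun x => by rw [Finset.mem_product, h₁, h₂], ?_⟩
        rw [List.length_take, min_eq_left (by omega)] at h₁'
        rw [List.length_drop, show l.length - i = j by omega] at h₂'
        rw [← h₁', ← h₂', Finset.sum_mul_sum, Finset.sum_product]
        simp only [pow_add]
    choose! s hs hsum using hsplit
    let cons : PlaneTree α × (Fin m → PlaneTree α) → (Fin (m + 1) → PlaneTree α) :=
      fun x => Fin.cons x.1 x.2
    have hinj : Function.Injective cons := by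
      rintro ⟨t, c⟩ ⟨t', c'⟩ h
      obtain ⟨h1, h2⟩ := Fin.cons_inj.1 h
      exact Prod.ext h1 h2
    refine ⟨(Finset.HasAntidiagonal.antidiagonal l.length).biUnion fun p => (s p).image cons, fun c => ?_, ?_⟩
    · simp only [Finset.mem_biUnion, Finset.mem_image]
      constructor
      · rintro ⟨p, hp, x, hx, rfl⟩
        obtain ⟨⟨h1, h2⟩, h3, h4⟩ := (hs p hp x).1 hx
        refine ⟨by rw [tupleLeaves_cons, h1, h3, List.take_append_drop], fun i => ?_⟩
        refine Fin.cases ?_ (fun i => ?_) i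
        · exact h2
        · exact h4 i
      · rintro ⟨h1, h2⟩
        have h3 : c = Fin.cons (c 0) (Fin.tail c) := (Fin.cons_self_tail c).symm
        rw [h3, tupleLeaves_cons] at h1
        refine ⟨((c 0).leaves.length, (tupleLeaves (Fin.tail c)).length), ?_,
          (c 0, Fin.tail c), ?_, h3.symm⟩
        · rw [Finset.HasAntidiagonal.mem_antidiagonal, ← h1, List.length_append]
        · rw [hs]
          · simp only
            rw [← h1, List.take_left, List.drop_left]
            exact ⟨⟨rfl, h2 0⟩, rfl, fun i => h2 i.succ⟩
          · rw [Finset.HasAntidiagonal.mem_antidiagonal, ← h1, List.length_append]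
    · rw [Finset.sum_biUnion, pow_succ', coeff_mul]
      · refine Finset.sum_congr rfl fun p hp => ?_
        rw [← hsum p hp, Finset.sum_image hinj.injOn]
        refine Finset.sum_congr rfl fun x _ => ?_
        rw [Fin.sum_univ_succ]
        rfl
      · intro p hp p' hp' hpp
        rw [Function.onFun, Finset.disjoint_left]
        intro c hc hc'
        obtain ⟨x, hx, rfl⟩ := Finset.mem_image.1 hc
        obtain ⟨x', hx', hxx⟩ := Finset.mem_image.1 hc'
        obtain rfl := hinj hxx
        have h1 := congrArg List.length ((hs p hp _).1 hx).1.1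
        have h2 := congrArg List.length ((hs p' hp' _).1 hx').1.1
        rw [Finset.mem_coe, Finset.HasAntidiagonal.mem_antidiagonal] at hp hp'
        rw [h1, List.length_take, List.length_take] at h2
        exact hpp (Prod.ext (by omega) (by omega))

/-- The admissible trees with leaves `l` are counted by the inverse of the tree kernel. -/
theorem exists_trees_eq_coeff (n : ℕ) : ∀ l : List α, l.length = n →
    ∃ s : Finset (PlaneTree α), (∀ t, t ∈ s ↔ t.leaves = l ∧ t.Admissible) ∧
      ∑ t ∈ s, (Polynomial.X : Polynomial ℤ) ^ t.excess =
        coeff l.length (OGForest.compInverse OGForest.treeKernel) := by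
  classical
  induction n using Nat.strong_induction_on with
  | _ n ih =>
    intro l hl
    have hg := OGForest.isCompInverse_treeKernel.2.1
    have htup := exists_tuples_eq_coeff hg (n := n) (fun l' hl' => ih _ hl' l' rfl)
    -- The condition on `m` is moved inside, with `∅` as default, so that one family of sets can be
    -- chosen for all `m`.
    have htup' : ∀ m, ∃ s : Finset (Fin m → PlaneTree α), 2 ≤ m →
        (∀ c, c ∈ s ↔ tupleLeaves c = l ∧ ∀ i, (c i).Admissible) ∧
        ∑ c ∈ s, (Polynomial.X : Polynomial ℤ) ^ (∑ i, (c i).excess) =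
          coeff l.length (OGForest.compInverse OGForest.treeKernel ^ m) := by
      intro m
      by_cases hm : 2 ≤ m
      · obtain ⟨s, hs⟩ := htup m l (Or.inr ⟨hl, hm⟩)
        exact ⟨s, fun _ => hs⟩
      · exact ⟨∅, fun h => absurd h hm⟩
    choose s hs using htup'
    let leafSet : Finset (PlaneTree α) := (l.toFinset.image leaf).filter fun t => t.leaves = l
    have hleaf : ∀ t, t ∈ leafSet ↔ ∃ a, l = [a] ∧ t = leaf a := by
      intro t
      simp only [leafSet, Finset.mem_filter, Finset.mem_image, List.mem_toFinset]
      constructor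
      · rintro ⟨⟨a, _, rfl⟩, h⟩
        exact ⟨a, by rw [← h, leaves], rfl⟩
      · rintro ⟨a, rfl, rfl⟩
        exact ⟨⟨a, by simp, rfl⟩, by rw [leaves]⟩
    -- A vertex with `m` children has at least `m` leaves below it, so finitely many `m` suffice;
    -- this yields finiteness together with the count.
    let M := (Finset.range (l.length + 1)).filter (fun m => Odd m ∧ 3 ≤ m)
    refine ⟨leafSet ∪ M.biUnion fun m => (s m).image (node m), fun t => ?_, ?_⟩
    · simp only [Finset.mem_union, Finset.mem_biUnion, Finset.mem_image, hleaf, M,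
        Finset.mem_filter, Finset.mem_range]
      cases t with
      | leaf a =>
        simp only [leaves, admissible_leaf, and_true, leaf.injEq, reduceCtorEq, and_false,
          exists_false, or_false]
        exact ⟨by rintro ⟨b, rfl, rfl⟩; rfl, fun h => ⟨a, h.symm, rfl⟩⟩
      | node m c =>
        rw [leaves_node, admissible_node]
        constructor
        · rintro (⟨a, _, h⟩ | ⟨m', hm, c', hc, h⟩)
          · cases h
          · cases h
            have := ((hs m (by omega)).1 c).1 hc
            exact ⟨this.1, hm.2, this.2⟩
        · rintro ⟨h1, h2, h3⟩
          refine Or.inr ⟨m, ⟨?_, h2⟩, c, ((hs m (by omega)).1 c).2 ⟨h1, h3⟩, rfl⟩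
          have := le_length_tupleLeaves h3
          rw [h1] at this
          omega
    · rw [OGForest.coeff_compInverse_treeKernel, Finset.sum_union, Finset.sum_biUnion]
      · congr 1
        · split_ifs with h1
          · obtain ⟨a, rfl⟩ := List.length_eq_one_iff.1 h1
            have : leafSet = {leaf a} := by
              ext t
              rw [hleaf, Finset.mem_singleton]
              exact ⟨by rintro ⟨b, hb, rfl⟩; cases hb; rfl, fun h => ⟨a, rfl, h⟩⟩
            rw [this, Finset.sum_singleton, excess_leaf, pow_zero]
          · refine Finset.sum_eq_zero fun t ht => ?_
            obtain ⟨a, rfl, _⟩ := (hleaf t).1 ht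
            exact absurd rfl h1
        · refine Finset.sum_congr rfl fun m hm => ?_
          have hm3 := (Finset.mem_filter.1 hm).2.2
          rw [← (hs m (by omega)).2, Finset.mul_sum, Finset.sum_image]
          · exact Finset.sum_congr rfl fun c _ => by rw [excess_node, pow_add]
          · intro c _ c' _ h
            cases h
            rfl
      · intro m _ m' _ hmm
        rw [Function.onFun, Finset.disjoint_left]
        intro t ht ht'
        obtain ⟨c, _, rfl⟩ := Finset.mem_image.1 ht
        obtain ⟨c', _, h⟩ := Finset.mem_image.1 ht'
        cases h
        exact hmm rfl
      · rw [Finset.disjoint_left]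
        intro t ht ht'
        obtain ⟨a, _, rfl⟩ := (hleaf t).1 ht
        obtain ⟨m, _, hm⟩ := Finset.mem_biUnion.1 ht'
        obtain ⟨c, _, h⟩ := Finset.mem_image.1 hm
        cases h

theorem excess_eq_zero_of_length_leaves_eq_one {t : PlaneTree α} (ht : t.Admissible)
    (h : t.leaves.length = 1) : t.excess = 0 := by
  cases t with
  | leaf a => exact excess_leaf a
  | node m c =>
    rw [admissible_node] at ht
    have := le_length_tupleLeaves ht.2
    rw [← leaves_node] at this
    omega

theorem finite_setOf_leaves_eq (l : List α) :
    {t : PlaneTree α | t.leaves = l ∧ t.Admissible}.Finite := by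
  obtain ⟨s, hs, -⟩ := exists_trees_eq_coeff l.length l rfl
  exact s.finite_toSet.subset fun t ht => (hs t).2 ht

end PlaneTree

/-! ### OG trees with prescribed external vertices -/

namespace OGTree

open PowerSeries

variable {N : ℕ}

/-- The case distinction in `dim` is harmless: with two external vertices the body has one leaf,
hence no internal vertex, since such a vertex has at least three leaves below it. -/
theorem dim_eq_excess (T : OGTree N) : T.dim = T.body.excess := by
  rw [dim]
  split_ifs with h
  · exact (PlaneTree.excess_eq_zero_of_length_leaves_eq_one T.even_degrees (by simpa [ext] using h)).symm
  · rfl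

theorem eq_of_root_body {T T' : OGTree N} (h : T.root = T'.root) (h' : T.body = T'.body) :
    T = T' := by
  cases T; cases T'; simp_all

instance : Finite (OGTree N) := by
  have hfin : {t : PlaneTree (Fin N) | t.leaves.length ≤ N ∧ t.Admissible}.Finite := by
    refine Set.Finite.subset ((List.finite_length_le (Fin N) N).biUnion fun l _ =>
      PlaneTree.finite_setOf_leaves_eq l) fun t ht => ?_
    exact Set.mem_biUnion (x := t.leaves) ht.1 ⟨rfl, ht.2⟩
  have := hfin.to_subtype
  have hlen (T : OGTree N) : T.body.leaves.length ≤ N := by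
    have h1 : T.body.leaves.Nodup := (List.pairwise_cons.1 T.planar).2.imp ne_of_lt
    simpa using h1.length_le_card
  refine Finite.of_injective (fun T : OGTree N =>
    (T.root, (⟨T.body, hlen T, T.even_degrees⟩ :
      {t : PlaneTree (Fin N) | t.leaves.length ≤ N ∧ t.Admissible}))) fun T T' h => ?_
  simp only [Prod.mk.injEq, Subtype.mk.injEq] at h
  exact eq_of_root_body h.1 h.2

/-- The set of the labels of the external vertices. -/
def extSet (T : OGTree N) : Finset ℕ := T.ext.toFinset.map Fin.valEmbedding

theorem mem_extSet {T : OGTree N} {i : ℕ} :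
    i ∈ T.extSet ↔ ∃ h : i < N, (⟨i, h⟩ : Fin N) ∈ T.ext := by
  simp only [extSet, Finset.mem_map, List.mem_toFinset, Fin.valEmbedding_apply]
  exact ⟨by rintro ⟨a, ha, rfl⟩; exact ⟨a.2, ha⟩, fun ⟨h, hi⟩ => ⟨_, hi, rfl⟩⟩

theorem val_mem_extSet {T : OGTree N} {i : Fin N} : (i : ℕ) ∈ T.extSet ↔ i ∈ T.ext := by
  simp [mem_extSet]

theorem extSet_nonempty (T : OGTree N) : T.extSet.Nonempty :=
  ⟨T.root, val_mem_extSet.2 (by simp [ext])⟩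

/-- Planarity makes the contour list strictly increasing, so it is recovered from its set of labels.
-/
theorem ext_eq_sort (T : OGTree N) : T.ext = T.ext.toFinset.sort :=
  ((List.toFinset_sort _ (T.planar.imp ne_of_lt)).2 (T.planar.imp le_of_lt)).symm

theorem setsCross_iff {T T' : OGTree N} : SetsCross T.extSet T'.extSet ↔ T.Crosses T' := by
  constructor
  · rintro ⟨a, b, c, d, hab, hbc, hcd, ha, hb, hc, hd⟩
    obtain ⟨_, ha⟩ := mem_extSet.1 ha
    obtain ⟨_, hb⟩ := mem_extSet.1 hb
    obtain ⟨_, hc⟩ := mem_extSet.1 hc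
    obtain ⟨_, hd⟩ := mem_extSet.1 hd
    exact ⟨_, _, _, _, hab, hbc, hcd, ha, hb, hc, hd⟩
  · rintro ⟨a, b, c, d, hab, hbc, hcd, ha, hb, hc, hd⟩
    exact ⟨a, b, c, d, hab, hbc, hcd, val_mem_extSet.2 ha, val_mem_extSet.2 hb,
      val_mem_extSet.2 hc, val_mem_extSet.2 hd⟩

open Classical in
/-- The trees with given external vertices are counted by `G_tree`. -/
theorem sum_extSet_eq [Fintype (OGTree N)] (B : Finset ℕ) (hB : B.Nonempty)
    (hBN : B ⊆ Finset.range N) :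
    ∑ T ∈ Finset.univ.filter (fun T : OGTree N => T.extSet = B),
      (Polynomial.X : Polynomial ℤ) ^ T.dim = coeff B.card OGForest.treeGF := by
  obtain ⟨B', rfl⟩ : ∃ B' : Finset (Fin N), B = B'.map Fin.valEmbedding := by
    refine ⟨Finset.univ.filter fun i : Fin N => (i : ℕ) ∈ B, ?_⟩
    ext i
    simp only [Finset.mem_map, Finset.mem_filter, Finset.mem_univ, true_and,
      Fin.valEmbedding_apply]
    exact ⟨fun h => ⟨⟨i, Finset.mem_range.1 (hBN h)⟩, h, rfl⟩, by rintro ⟨a, ha, rfl⟩; exact ha⟩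
  have hext : ∀ T : OGTree N, T.extSet = B'.map Fin.valEmbedding ↔ T.ext = B'.sort := by
    intro T
    rw [extSet, Finset.map_inj]
    constructor
    · rintro rfl
      exact ext_eq_sort T
    · intro h
      rw [h, Finset.sort_toFinset]
  have hlen := Finset.length_sort (s := B') (· ≤ ·)
  have hpair : B'.sort.Pairwise (· < ·) := (Finset.sortedLT_sort B').pairwise
  rw [Finset.card_map, ← hlen]
  cases hl : B'.sort with
  | nil =>
    rw [hl] at hlen
    rw [eq_comm, List.length_nil, Finset.card_eq_zero] at hlen
    simp [hlen] at hB
  -- The least label `b` must be the root and `l` the leaves of the body; the root accounts for the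
  -- factor x in `treeGF`.
  | cons b l =>
    rw [hl] at hpair
    rw [List.length_cons, OGForest.treeGF, coeff_succ_X_mul]
    obtain ⟨s, hs, hsum⟩ := PlaneTree.exists_trees_eq_coeff l.length l rfl
    rw [← hsum]
    refine Finset.sum_bij' (fun T _ => T.body)
      (fun t ht => ⟨b, t, by rw [((hs t).1 ht).1]; exact hpair, ((hs t).1 ht).2⟩) ?_ ?_ ?_ ?_ ?_
    · intro T hT
      rw [Finset.mem_filter, hext, hl, ext, List.cons.injEq] at hT
      exact (hs _).2 ⟨hT.2.2, T.even_degrees⟩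
    · intro t ht
      rw [Finset.mem_filter, hext, hl]
      exact ⟨Finset.mem_univ _, congrArg (b :: ·) ((hs t).1 ht).1⟩
    · intro T hT
      rw [Finset.mem_filter, hext, hl, ext, List.cons.injEq] at hT
      exact eq_of_root_body hT.2.1.symm rfl
    · intro t _
      rfl
    · intro T _
      rw [dim_eq_excess]

end OGTree

/-! ### OG forests as tilings, and the Euler characteristic -/

namespace OGForest

open PowerSeries

variable {k : ℕ}

theorem trees_injective : Function.Injective (OGForest.trees (k := k)) := by
  intro F F' h
  cases F; cases F'; simp_all

instance : Finite (OGForest k) := Finite.of_injective _ trees_injective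

theorem ncTiling_trees (F : OGForest k) :
    NCTiling OGTree.extSet (Finset.Ico 0 (2 * k)) F.trees := by
  refine ⟨fun i => ⟨fun hi => ?_, ?_⟩, fun T hT T' hT' i hi hi' => ?_, fun T hT T' hT' hne => ?_⟩
  · obtain ⟨T, ⟨hT, hi'⟩, -⟩ := F.cover ⟨i, (Finset.mem_Ico.1 hi).2⟩
    exact ⟨T, hT, OGTree.mem_extSet.2 ⟨_, hi'⟩⟩
  · rintro ⟨T, hT, hi⟩
    obtain ⟨h, -⟩ := OGTree.mem_extSet.1 hi
    exact Finset.mem_Ico.2 ⟨Nat.zero_le _, h⟩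
  · obtain ⟨h, hi⟩ := OGTree.mem_extSet.1 hi
    obtain ⟨_, hi₂⟩ := OGTree.mem_extSet.1 hi'
    exact (F.cover ⟨i, h⟩).unique ⟨hT, hi⟩ ⟨hT', hi₂⟩
  · rw [OGTree.setsCross_iff]
    exact F.noncrossing T hT T' hT' hne

theorem exists_trees_eq {Q : Finset (OGTree (2 * k))}
    (h : NCTiling OGTree.extSet (Finset.Ico 0 (2 * k)) Q) : ∃ F : OGForest k, F.trees = Q := by
  refine ⟨⟨Q, fun i => ?_, fun T hT T' hT' hne => ?_⟩, rfl⟩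
  · obtain ⟨T, hT, hi⟩ := (h.mem_iff i).1 (Finset.mem_Ico.2 ⟨Nat.zero_le _, i.2⟩)
    exact ⟨T, ⟨hT, OGTree.val_mem_extSet.1 hi⟩, fun T' hT' =>
      h.eq_of_mem T' hT'.1 T hT i (OGTree.val_mem_extSet.2 hT'.2) hi⟩
  · rw [← OGTree.setsCross_iff]
    exact h.not_cross T hT T' hT' hne

theorem shiftSeries_treeGF : shiftSeries (fun n => coeff n treeGF) 0 = treeGF := by
  ext1 n
  rw [shiftSeries, coeff_mk]
  split_ifs with h
  · simp [h, treeGF]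
  · rfl

theorem coeff_forestGF (k : ℕ) :
    coeff (2 * k) forestGF = ∑ᶠ F : OGForest k, (Polynomial.X : Polynomial ℤ) ^ F.dim := by
  classical
  have := Fintype.ofFinite (OGTree (2 * k))
  have := Fintype.ofFinite (OGForest k)
  rw [← (tilingSum_Ico OGTree.extSet (fun T : OGTree (2 * k) =>
      (Polynomial.X : Polynomial ℤ) ^ T.dim) OGTree.extSet_nonempty (N := 2 * k)
      (t := fun n => coeff n treeGF) (fun B hB hBN => OGTree.sum_extSet_eq B hB hBN)
      (Φ := forestGF) (by rw [shiftSeries_treeGF]; exact forestGF_eq) (2 * k) 0 (2 * k)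
      (by omega) le_rfl).1, finsum_eq_sum_of_fintype, tilingSum]
  symm
  refine Finset.sum_bij (fun F _ => F.trees) ?_ ?_ ?_ ?_
  · exact fun F _ => Finset.mem_filter.2 ⟨Finset.mem_univ _, ncTiling_trees F⟩
  · exact fun F _ F' _ h => trees_injective h
  · intro Q hQ
    obtain ⟨F, hF⟩ := exists_trees_eq (Finset.mem_filter.1 hQ).2
    exact ⟨F, Finset.mem_univ _, hF⟩
  · intro F _
    rw [Finset.prod_pow_eq_pow_sum, dim]

/-- The forests are grouped by dimension; dimensions that do not occur contribute zero. -/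
theorem eulerChar_eq (k : ℕ) : eulerChar k = ∑ᶠ F : OGForest k, (-1 : ℤ) ^ F.dim := by
  classical
  have := Fintype.ofFinite (OGForest k)
  have hf (d : ℕ) : fVector k d = (Finset.univ.filter fun F : OGForest k => F.dim = d).card := by
    rw [fVector, Nat.card_eq_fintype_card, Fintype.card_subtype]
  rw [eulerChar, finsum_eq_sum_of_fintype (fun F : OGForest k => (-1 : ℤ) ^ F.dim),
    finsum_eq_sum_of_support_subset (s := Finset.univ.image (dim (k := k))),
    ← Finset.sum_fiberwise_of_maps_to (g := dim (k := k))
      (fun F _ => Finset.mem_image_of_mem _ (Finset.mem_univ F))]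
  · refine Finset.sum_congr rfl fun d _ => ?_
    rw [hf, Finset.sum_congr rfl (g := fun _ => (-1 : ℤ) ^ d)
      (fun F hF => by rw [(Finset.mem_filter.1 hF).2]), Finset.sum_const, nsmul_eq_mul, mul_comm]
  · intro d hd
    by_contra hn
    refine hd ?_
    have : (Finset.univ.filter fun F : OGForest k => F.dim = d) = ∅ :=
      Finset.filter_eq_empty_iff.2 fun F _ h =>
        hn (Finset.mem_coe.2 (Finset.mem_image.2 ⟨F, Finset.mem_univ _, h⟩))
    simp [hf, this]

theorem eulerChar_eq_eval (k : ℕ) : eulerChar k = (coeff (2 * k) forestGF).eval (-1 : ℤ) := by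
  have := Fintype.ofFinite (OGForest k)
  rw [eulerChar_eq, coeff_forestGF, finsum_eq_sum_of_fintype, finsum_eq_sum_of_fintype,
    Polynomial.eval_finsetSum]
  simp

theorem eval_coeff_forestGF (k : ℕ) : (coeff (2 * k) forestGF).eval (-1 : ℤ) = 1 := by
  have h := one_sub_X_sq_mul_map_forestGF
  rw [sub_mul, one_mul] at h
  have hc (n : ℕ) : coeff n (PowerSeries.map (Polynomial.evalRingHom (-1 : ℤ)) forestGF) =
      (coeff n forestGF).eval (-1 : ℤ) := by simp
  induction k with
  | zero =>
    have := congrArg (coeff 0) h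
    rw [map_sub, hc, coeff_X_pow_mul'] at this
    simpa using this
  | succ k ih =>
    -- In positive degree the relation (1 - x ^ 2) p = 1 says that coefficients two apart agree.
    have := congrArg (coeff (2 * k + 2)) h
    rw [map_sub, hc, coeff_X_pow_mul, hc, ih, coeff_one, if_neg (by omega)] at this
    rw [show 2 * (k + 1) = 2 * k + 2 by ring]
    linarith

end OGForest

theorem mainTheorem1 :
    -- the two compositional inverses in the definition of the generating functions exist
    OGForest.IsCompInverse OGForest.treeKernel (OGForest.compInverse OGForest.treeKernel) ∧
    OGForest.IsCompInverse OGForest.forestKernel (OGForest.compInverse OGForest.forestKernel) ∧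
    -- `G_forest(x, -1) = 1 / (1 - x ^ 2)`
    (1 - PowerSeries.X ^ 2) *
      PowerSeries.map (Polynomial.evalRingHom (-1 : ℤ)) OGForest.forestGF = 1 ∧
    ∀ k : ℕ,
      Finite (OGForest k) ∧
      -- `[x ^ (2k)] G_forest(x, q)` is the sum of `q ^ dim F` over the OG forests of type `k`
      PowerSeries.coeff (2 * k) OGForest.forestGF =
        ∑ᶠ F : OGForest k, (Polynomial.X : Polynomial ℤ) ^ F.dim ∧
      -- `χ` is the alternating sum over all OG forests of type `k`, and equals `1`
      OGForest.eulerChar k = ∑ᶠ F : OGForest k, (-1 : ℤ) ^ F.dim ∧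
      OGForest.eulerChar k =
        (PowerSeries.coeff (2 * k) OGForest.forestGF).eval (-1 : ℤ) ∧
      OGForest.eulerChar k = 1 :=
  ⟨OGForest.isCompInverse_treeKernel, OGForest.isCompInverse_forestKernel,
    OGForest.one_sub_X_sq_mul_map_forestGF, fun k =>
      ⟨inferInstance, OGForest.coeff_forestGF k, OGForest.eulerChar_eq k,
        OGForest.eulerChar_eq_eval k,
        (OGForest.eulerChar_eq_eval k).trans (OGForest.eval_coeff_forestGF k)⟩⟩
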